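/- Let $N\simeq\mathbb{Z}^n$ be a lattice, $N_{\mathbb{R}}=N\otimes\mathbb{R}$ and $M_{\mathbb{R}}=N_{\mathbb{R}}^{\vee}$. A polyhedron in $N_{\mathbb{R}}$ is a finite intersection of closed halfspaces $\{u : \langle x,u\rangle\le b\}$; it is rational if these can be chosen with $x\in M_{\mathbb{R}}$ taking rational values on $N$ and $b\in\mathbb{Q}$, and strongly convex if it contains no line. A polytope is the convex hull of a finite set, and a convex polyhedral cone is the convex cone (containing $0$) generated by a finite set of vectors. A face of a polyhedron $\Lambda$ is a non-empty set of the form $\{u\in\Lambda : \langle x,u\rangle\le\langle x,v\rangle\ \forall v\in\Lambda\}$ with $x\in M_{\mathbb{R}}$. A polyhedral complex is a non-empty finite collection $\Pi$ of non-empty polyhedra that contains every face of each of its elements and in which any two elements are either disjoint or intersect in a common face; its support is $|\Pi|=\bigcup_{\Lambda\in\Pi}\Lambda$. It is rational (resp. strongly convex) if all its elements are, and conic if all its elements are convex polyhedral cones; a fan is a strongly convex conic polyhedral complex. The same notions are used in $N_{\mathbb{R}}\times\mathbb{R}$ with the lattice $N\times\mathbb{Z}$; a complex is said to be in a set $E$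 if its support is contained in $E$. For $E\subset N_{\mathbb{R}}$ put $$\operatorname{rec}(E)=\{u\in N_{\mathbb{R}} : p+\lambda u\in E\ \ \forall p\in E,\ \forall \lambda\ge 0\},\qquad \operatorname{c}(E)=\overline{\mathbb{R}_{>0}(E\times\{1\})}\subset N_{\mathbb{R}}\times\mathbb{R}_{\ge0},$$ and for a polyhedral complex $\Pi$ put $\operatorname{rec}(\Pi)=\{\operatorname{rec}(\Lambda) : \Lambda\in\Pi\}$ and $\operatorname{c}(\Pi)=\{\operatorname{c}(\Lambda) : \Lambda\in\Pi\}\cup\{\sigma\times\{0\} : \sigma\in\operatorname{rec}(\Pi)\}$. **Theorem.** Let $\Pi$ be a polyhedral complex in $N_{\mathbb{R}}$ whose support $|\Pi|$ is connected and satisfies the Minkowski–Weyl condition, i.e. $|\Pi|=\Delta+\sigma$ with $\Delta$ a finite union of polytopes and $\sigma$ a convex polyhedral cone. Then 1. $\operatorname{rec}(\Pi)$ is a conic polyhedral complex in $N_{\mathbb{R}}$ and $|\operatorname{rec}(\Pi)|=\operatorname{rec}(|\Pi|)$; 2. $\operatorname{c}(\Pi)$ is a conic polyhedral complex in $N_{\mathbb{R}}\times\mathbb{R}_{\ge0}$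 and $|\operatorname{c}(\Pi)|=\operatorname{c}(|\Pi|)$; 3. if, in addition, $\Pi$ is rational (resp. strongly convex), then both $\operatorname{rec}(\Pi)$ and $\operatorname{c}(\Pi)$ are rational (resp. fans). -/

import Mathlib

open scoped Pointwise

section Polyhedra

variable {V : Type*} [AddCommGroup V] [Module ℝ V]

/-- A polyhedron: the intersection of finitely many closed halfspaces `{u | f u ≤ b}`. -/
def IsPolyhedron (P : Set V) : Prop :=
  ∃ H : Set (Module.Dual ℝ V × ℝ), H.Finite ∧ P = {u : V | ∀ h ∈ H, h.1 u ≤ h.2}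

/-- A polyhedron that is rational with respect to the lattice `L`: the finitely many halfspaces
can be chosen of the form `{u | f u ≤ b}` with `b` rational and `f` rational, that is,
taking rational values on `L`. -/
def IsRationalPolyhedron (L : Submodule ℤ V) (P : Set V) : Prop :=
  ∃ H : Set (Module.Dual ℝ V × ℝ), H.Finite ∧
    (∀ h ∈ H, (∀ l ∈ L, ∃ q : ℚ, h.1 l = (q : ℝ)) ∧ ∃ q : ℚ, h.2 = (q : ℝ)) ∧
    P = {u : V | ∀ h ∈ H, h.1 u ≤ h.2}

/-- The set contains no (affine) line. -/
def ContainsNoLine (P : Set V) : Prop :=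
  ¬ ∃ p v : V, v ≠ 0 ∧ ∀ t : ℝ, p + t • v ∈ P

/-- A polytope: the convex hull of a finite set of points. -/
def IsPolytope (P : Set V) : Prop :=
  ∃ s : Set V, s.Finite ∧ P = convexHull ℝ s

/-- A convex polyhedral cone: the convex cone (with apex `0`) generated by a finite set. -/
def IsConvexPolyhedralCone (σ : Set V) : Prop :=
  ∃ s : Set V, s.Finite ∧ σ = (PointedCone.hull ℝ s : Set V)

/-- The set of points of `P` where the linear form `x` attains its minimum over `P`. -/
def minimizers (P : Set V) (x : Module.Dual ℝ V) : Set V :=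
  {u : V | u ∈ P ∧ ∀ v ∈ P, x u ≤ x v}

/-- `F` is a face of `P`: a non-empty subset on which some linear form attains its minimum. -/
def IsFaceOf (F P : Set V) : Prop :=
  F.Nonempty ∧ ∃ x : Module.Dual ℝ V, F = minimizers P x

/-- The recession cone of a set `E`, the intersection over all `p ∈ E` of the local recession
cones `{u | p + λ u ∈ E for all λ ≥ 0}`. -/
def recCone (E : Set V) : Set V :=
  {u : V | ∀ p ∈ E, ∀ r : ℝ, 0 ≤ r → p + r • u ∈ E}

/-- `E = Δ + σ` with `Δ` a finite union of polytopes and `σ` a convex polyhedral cone. -/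
def MinkowskiWeylCondition (E : Set V) : Prop :=
  ∃ (D : Set (Set V)) (σ : Set V), D.Finite ∧ (∀ K ∈ D, IsPolytope K) ∧
    IsConvexPolyhedralCone σ ∧ E = ⋃₀ D + σ

/-- A polyhedral complex: a non-empty finite collection of non-empty polyhedra that is closed
under taking faces, and in which two elements are disjoint or meet in a common face. -/
structure IsPolyhedralComplex (C : Set (Set V)) : Prop where
  nonempty : C.Nonempty
  finite : C.Finite
  isPolyhedron : ∀ P ∈ C, IsPolyhedron P
  nonempty_of_mem : ∀ P ∈ C, P.Nonempty
  face_mem : ∀ P ∈ C, ∀ F : Set V, IsFaceOf F P → F ∈ C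
  inter_face : ∀ P ∈ C, ∀ Q ∈ C, Disjoint P Q ∨ (IsFaceOf (P ∩ Q) P ∧ IsFaceOf (P ∩ Q) Q)

/-- All elements of the collection are rational with respect to the lattice `L`. -/
def IsRationalCollection (L : Submodule ℤ V) (C : Set (Set V)) : Prop :=
  ∀ P ∈ C, IsRationalPolyhedron L P

/-- All elements of the collection are strongly convex, i.e. contain no line. -/
def IsStronglyConvexCollection (C : Set (Set V)) : Prop :=
  ∀ P ∈ C, ContainsNoLine P

/-- A conic polyhedral complex: a polyhedral complex all of whose elements are cones. -/
def IsConicComplex (C : Set (Set V)) : Prop :=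
  IsPolyhedralComplex C ∧ ∀ P ∈ C, IsConvexPolyhedralCone P

/-- A fan: a strongly convex conic polyhedral complex. -/
def IsPolyhedralFan (C : Set (Set V)) : Prop :=
  IsConicComplex C ∧ IsStronglyConvexCollection C

/-- The support of a collection of sets. -/
def complexSupport (C : Set (Set V)) : Set V := ⋃₀ C

/-- The recession of a collection of polyhedra: the collection of their recession cones. -/
def recComplex (C : Set (Set V)) : Set (Set V) := recCone '' C

/-- The lattice `N × ℤ` in `N_ℝ × ℝ`, where `L` is the lattice `N` in `N_ℝ`. -/
def latticeProdInt (L : Submodule ℤ V) : Submodule ℤ (V × ℝ) :=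
  L.prod (Submodule.span ℤ {(1 : ℝ)})

end Polyhedra

section Cone

variable {V : Type*} [NormedAddCommGroup V] [NormedSpace ℝ V]

/-- The cone of a set `E`: the closure of `ℝ_{>0} (E × {1})` in `V × ℝ`. -/
def coneOver (E : Set V) : Set (V × ℝ) :=
  closure (Set.Ioi (0 : ℝ) • (E ×ˢ ({1} : Set ℝ)))

/-- The cone of a collection of polyhedra: the cones of its elements, together with `σ × {0}` for
the elements `σ` of its recession. -/
def coneComplex (C : Set (Set V)) : Set (Set (V × ℝ)) :=
  coneOver '' C ∪ (fun σ : Set V => σ ×ˢ ({0} : Set ℝ)) '' recComplex C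

end Cone

/-! The faces of `recCone P` are recession cones of faces of `P`, because a linear form that is
nonnegative on the recession cone attains its minimum on `P`. So the difficulty in (1) is that two
recession cones meet in a common face. This is tested pointwise: let `minFace K u` be the smallest
face of `K` containing `u`. If the smallest faces of two polyhedral cones agree at each common
point, then taking `u` in the relative interior of the intersection identifies the intersection with
a face of both (`isFaceOf_inter_of_minFace_eq`).

The agreement comes from connectedness (`minFace_recCone_eq`). Let `u` be a recession direction of
the support. Each ray in direction `u` that starts in the support eventually lies in one member `R`
with `u ∈ recCone R`, and the starting points served by a given `R` form a closed set. Were there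
two values of the smallest face through `u`, sorting the members by value would cover the support by
two closed sets, both meeting it. These share a point of the support, hence two members with
different values contain the same ray eventually. They meet in a common face having `u` as recession
direction, which forces the values to agree.

The Minkowski–Weyl condition enters through `mem_recCone_of_ray`: a direction with one ray in the
support is a recession direction of all of it.

For (2), at height zero the smallest faces of the cones over members are those of the recession
cones, and at positive height two cones meet only over common points of the members. For (3), all
the cones have explicit inequalities obtained from those of `P`, which carry over rationality and
turn a line in a cone into a line in `P`. -/

open Filter Topology in
/-- A real affine function of `r` that is frequently bounded above as `r → ∞` has nonpositive
slope. -/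
theorem slope_nonpos_of_frequently_le {a b c : ℝ} (h : ∃ᶠ r : ℝ in atTop, a + r * c ≤ b) :
    c ≤ 0 := by
  by_contra! hc
  refine h ?_
  have : Tendsto (fun r : ℝ => a + r * c) atTop atTop :=
    tendsto_atTop_add_const_left _ _ (tendsto_id.atTop_mul_const hc)
  filter_upwards [this.eventually_gt_atTop b] with r hr
  exact not_le.2 hr

/-! ### Cones given by homogeneous inequalities. -/

section Cones

variable {V : Type*} [AddCommGroup V] [Module ℝ V]

/-- The cone cut out by the homogeneous inequalities `f u ≤ 0` for `f ∈ S`. -/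
def polarCone (S : Set (Module.Dual ℝ V)) : Set V := {u | ∀ f ∈ S, f u ≤ 0}

/-- The polyhedron cut out by the inequalities `h.1 u ≤ h.2` for `h ∈ H`. -/
def polyhedronOf (H : Set (Module.Dual ℝ V × ℝ)) : Set V := {u | ∀ h ∈ H, h.1 u ≤ h.2}

theorem zero_mem_polarCone (S : Set (Module.Dual ℝ V)) : (0 : V) ∈ polarCone S :=
  fun f _ => by simp

theorem add_mem_polarCone {S : Set (Module.Dual ℝ V)} {u v : V} (hu : u ∈ polarCone S)
    (hv : v ∈ polarCone S) : u + v ∈ polarCone S := fun f hf => by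
  rw [map_add]; exact add_nonpos (hu f hf) (hv f hf)

theorem smul_mem_polarCone {S : Set (Module.Dual ℝ V)} {u : V} {c : ℝ} (hc : 0 ≤ c)
    (hu : u ∈ polarCone S) : c • u ∈ polarCone S := fun f hf => by
  rw [map_smul, smul_eq_mul]; exact mul_nonpos_of_nonneg_of_nonpos hc (hu f hf)

theorem polarCone_union (S T : Set (Module.Dual ℝ V)) :
    polarCone (S ∪ T) = polarCone S ∩ polarCone T := by
  ext u
  simp only [polarCone, Set.mem_union, Set.mem_ofPred_eq, Set.mem_inter_iff, or_imp, forall_and]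

theorem mem_polarCone_insert {f : Module.Dual ℝ V} {S : Set (Module.Dual ℝ V)} {u : V} :
    u ∈ polarCone (insert f S) ↔ f u ≤ 0 ∧ u ∈ polarCone S := by
  simp [polarCone]

theorem isPolyhedron_polarCone {S : Set (Module.Dual ℝ V)} (hS : S.Finite) :
    IsPolyhedron (polarCone S) :=
  ⟨(fun f => (f, 0)) '' S, hS.image _, by ext; simp [polarCone]⟩

theorem isRationalPolyhedron_polarCone {L : Submodule ℤ V} {S : Set (Module.Dual ℝ V)}
    (hS : S.Finite) (hL : ∀ f ∈ S, ∀ l ∈ L, ∃ q : ℚ, f l = (q : ℝ)) :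
    IsRationalPolyhedron L (polarCone S) := by
  refine ⟨(fun f => (f, 0)) '' S, hS.image _, ?_, by ext; simp [polarCone]⟩
  rintro _ ⟨f, hf, rfl⟩
  exact ⟨hL f hf, 0, by simp⟩

/-- A line contained in a cone `polarCone S` is parallel to a vector on which `S` vanishes. -/
theorem eq_zero_of_line_mem_polarCone {S : Set (Module.Dual ℝ V)} {p v : V}
    (h : ∀ t : ℝ, p + t • v ∈ polarCone S) {f : Module.Dual ℝ V} (hf : f ∈ S) : f v = 0 := by
  have key : ∀ t : ℝ, f p + t * f v ≤ 0 := fun t => by simpa using h t f hf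
  refine le_antisymm (slope_nonpos_of_frequently_le (Filter.Frequently.of_forall key)) ?_
  have : -f v ≤ 0 := slope_nonpos_of_frequently_le (a := f p) (b := 0)
    (Filter.Frequently.of_forall fun r => by simpa using key (-r))
  linarith

/-! ### Finite generation of polyhedral cones. -/

section DoubleDescription

/-- The generators of `hull T ∩ {f ≤ 0}` given by the double description method. -/
def halfspaceGenerators (f : Module.Dual ℝ V) (T : Set V) : Set V :=
  {t ∈ T | f t ≤ 0} ∪
    (fun p : V × V => f p.1 • p.2 - f p.2 • p.1) '' ({t ∈ T | 0 < f t} ×ˢ {t ∈ T | f t ≤ 0})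

theorem finite_halfspaceGenerators (f : Module.Dual ℝ V) {T : Set V} (hT : T.Finite) :
    (halfspaceGenerators f T).Finite :=
  (hT.sep _).union (((hT.sep _).prod (hT.sep _)).image _)

/-- The expression is bilinear in `a` and `b`, so an induction in each variable reduces to pairs of
generators. -/
theorem combination_mem_hull_halfspaceGenerators (f : Module.Dual ℝ V) (T : Set V) {a b : V}
    (ha : a ∈ PointedCone.hull ℝ {t ∈ T | 0 < f t})
    (hb : b ∈ PointedCone.hull ℝ {t ∈ T | f t ≤ 0}) :
    f a • b - f b • a ∈ PointedCone.hull ℝ (halfspaceGenerators f T) := by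
  induction ha using Submodule.span_induction with
  | zero => simp
  | add x y _ _ hx hy =>
    convert add_mem hx hy using 1
    simp only [map_add]; module
  | smul c x _ hx =>
    convert Submodule.smul_mem _ c hx using 1
    rw [← Nonneg.coe_smul, ← Nonneg.coe_smul, map_smul, smul_eq_mul]; module
  | mem x hx =>
    induction hb using Submodule.span_induction with
    | zero => simp
    | add y z _ _ hy hz =>
      convert add_mem hy hz using 1
      simp only [map_add]; module
    | smul c y _ hy =>
      convert Submodule.smul_mem _ c hy using 1
      rw [← Nonneg.coe_smul, ← Nonneg.coe_smul, map_smul, smul_eq_mul]; module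
    | mem y hy => exact Submodule.subset_span (Or.inr ⟨(x, y), ⟨hx, hy⟩, rfl⟩)

theorem pos_or_eq_zero_of_mem_hull {f : Module.Dual ℝ V} {T : Set V} (hT : ∀ t ∈ T, 0 < f t)
    {a : V} (ha : a ∈ PointedCone.hull ℝ T) : 0 < f a ∨ a = 0 := by
  induction ha using Submodule.span_induction with
  | zero => exact Or.inr rfl
  | add x y _ _ hx hy =>
    rcases hx with hx | rfl
    · rcases hy with hy | rfl
      · left; rw [map_add]; positivity
      · left; simpa using hx
    · simpa using hy
  | smul c x _ hx =>
    rw [← Nonneg.coe_smul]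
    rcases hx with hx | rfl
    · rcases c.2.eq_or_lt with hc | hc
      · right; rw [← hc, zero_smul]
      · left; rw [map_smul]; exact mul_pos hc hx
    · right; simp
  | mem x hx => exact Or.inl (hT x hx)

theorem map_nonpos_of_mem_hull {f : Module.Dual ℝ V} {T : Set V} (hT : ∀ t ∈ T, f t ≤ 0)
    {a : V} (ha : a ∈ PointedCone.hull ℝ T) : f a ≤ 0 := by
  induction ha using Submodule.span_induction with
  | zero => simp
  | add x y _ _ hx hy => rw [map_add]; exact add_nonpos hx hy
  | smul c x _ hx =>
    rw [← Nonneg.coe_smul, map_smul]; exact mul_nonpos_of_nonneg_of_nonpos c.2 hx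
  | mem x hx => exact hT x hx

theorem hull_inter_halfspace (f : Module.Dual ℝ V) (T : Set V) :
    (PointedCone.hull ℝ T : Set V) ∩ {u | f u ≤ 0} =
      PointedCone.hull ℝ (halfspaceGenerators f T) := by
  apply Set.Subset.antisymm
  · rintro u ⟨hu, hfu⟩
    have hT : T = {t ∈ T | 0 < f t} ∪ {t ∈ T | f t ≤ 0} := by
      ext t
      simp only [Set.mem_union, Set.mem_ofPred_eq, ← and_or_left]
      exact (and_iff_left (lt_or_ge 0 (f t))).symm
    rw [SetLike.mem_coe, PointedCone.hull, hT, Submodule.span_union, Submodule.mem_sup] at hu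
    obtain ⟨a, ha, b, hb, rfl⟩ := hu
    have hb' : b ∈ PointedCone.hull ℝ (halfspaceGenerators f T) :=
      Submodule.span_mono Set.subset_union_left hb
    rcases pos_or_eq_zero_of_mem_hull (fun t ht => ht.2) ha with hfa | rfl
    · simp only [Set.mem_ofPred_eq, map_add] at hfu
      have hN : 0 < -f b := by linarith
      -- With `c = (-f b)⁻¹` one has `a + b = c • (f a • b - f b • a) + (1 - c * f a) • b`, and `1 -
      -- c * f a ≥ 0` because `f a + f b ≤ 0`.
      have h1 := PointedCone.smul_mem _ (inv_nonneg.2 hN.le)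
        (combination_mem_hull_halfspaceGenerators f T ha hb)
      have h2 := PointedCone.smul_mem _ (r := 1 - (-f b)⁻¹ * f a)
        (by rw [sub_nonneg, inv_mul_le_iff₀ hN]; linarith) hb'
      rw [SetLike.mem_coe]
      convert add_mem h1 h2 using 1
      have : (-f b)⁻¹ * f b = -1 := by
        rw [inv_neg, neg_mul, inv_mul_cancel₀ (neg_pos.1 hN).ne]
      rw [smul_sub, smul_smul, smul_smul, this]
      module
    · simpa using hb'
  · intro u hu
    refine ⟨?_, map_nonpos_of_mem_hull (fun t ht => ?_) hu⟩
    · refine Submodule.span_le.2 ?_ hu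
      rintro t (ht | ⟨⟨p, q⟩, ⟨hp, hq⟩, rfl⟩)
      · exact Submodule.subset_span ht.1
      · simp only [sub_eq_add_neg, ← neg_smul]
        exact add_mem (PointedCone.smul_mem _ hp.2.le (Submodule.subset_span hq.1))
          (PointedCone.smul_mem _ (neg_nonneg.2 hq.2) (Submodule.subset_span hp.1))
    · rcases ht with ht | ⟨⟨p, q⟩, -, rfl⟩
      · exact ht.2
      · simp [mul_comm]

theorem exists_finite_hull_eq_univ [FiniteDimensional ℝ V] :
    ∃ T : Set V, T.Finite ∧ (Set.univ : Set V) = PointedCone.hull ℝ T := by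
  let b := Module.finBasis ℝ V
  refine ⟨Set.range b ∪ Set.range (fun i => -b i),
    (Set.finite_range _).union (Set.finite_range _), ?_⟩
  symm
  refine Set.eq_univ_of_forall fun u => ?_
  rw [← b.sum_repr u]
  refine sum_mem fun i _ => ?_
  rcases le_total 0 (b.repr u i) with h | h
  · exact PointedCone.smul_mem _ h (Submodule.subset_span (Or.inl ⟨i, rfl⟩))
  · have := PointedCone.smul_mem _ (neg_nonneg.2 h)
      (Submodule.subset_span (s := Set.range b ∪ Set.range (fun i => -b i)) (Or.inr ⟨i, rfl⟩))
    simpa using this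

/-- The Minkowski–Weyl theorem for cones: finitely many homogeneous inequalities define a finitely
generated cone. -/
theorem isConvexPolyhedralCone_polarCone [FiniteDimensional ℝ V] {S : Set (Module.Dual ℝ V)}
    (hS : S.Finite) : IsConvexPolyhedralCone (polarCone S) := by
  induction S, hS using Set.Finite.induction_on with
  | empty =>
    obtain ⟨T, hT, h⟩ := exists_finite_hull_eq_univ (V := V)
    exact ⟨T, hT, by rw [← h]; ext; simp [polarCone]⟩
  | @insert f S _ _ ih =>
    obtain ⟨T, hT, h⟩ := ih
    refine ⟨halfspaceGenerators f T, finite_halfspaceGenerators f hT, ?_⟩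
    rw [← hull_inter_halfspace, ← h]
    ext u
    rw [mem_polarCone_insert]
    exact and_comm

end DoubleDescription

/-! ### Smallest faces, and a pointwise criterion for conic complexes. -/

section MinFace

/-- The smallest face of the cone `K` that contains `u`. -/
def minFace (K : Set V) (u : V) : Set V := {v | v ∈ K ∧ ∃ t : ℝ, 0 ≤ t ∧ t • u - v ∈ K}

/-- A nonempty set of minimizers on a cone is the zero set of a form which is nonnegative there. -/
theorem nonneg_and_minimizers_eq_of_nonempty {S : Set (Module.Dual ℝ V)} {x : Module.Dual ℝ V}
    (h : (minimizers (polarCone S) x).Nonempty) :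
    (∀ v ∈ polarCone S, 0 ≤ x v) ∧
      minimizers (polarCone S) x = {v | v ∈ polarCone S ∧ x v = 0} := by
  obtain ⟨u, hu, hmin⟩ := h
  have h0 : x u ≤ 0 := by simpa using hmin 0 (zero_mem_polarCone S)
  have h2 : x u ≤ x ((2 : ℝ) • u) := hmin _ (smul_mem_polarCone zero_le_two hu)
  rw [map_smul, smul_eq_mul] at h2
  have hxu : x u = 0 := by linarith
  have hnn : ∀ v ∈ polarCone S, 0 ≤ x v := fun v hv => hxu ▸ hmin v hv
  refine ⟨hnn, Set.ext fun v => ⟨fun hv => ⟨hv.1, le_antisymm ?_ (hnn v hv.1)⟩, fun hv =>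
    ⟨hv.1, fun w hw => hv.2.symm ▸ hnn w hw⟩⟩⟩
  simpa using hv.2 0 (zero_mem_polarCone S)

theorem isFaceOf_polarCone {S : Set (Module.Dual ℝ V)} {x : Module.Dual ℝ V}
    (hx : ∀ v ∈ polarCone S, 0 ≤ x v) :
    IsFaceOf {v | v ∈ polarCone S ∧ x v = 0} (polarCone S) := by
  have h0 : (0 : V) ∈ minimizers (polarCone S) x :=
    ⟨zero_mem_polarCone S, fun v hv => by simpa using hx v hv⟩
  exact ⟨⟨0, zero_mem_polarCone S, map_zero x⟩, x,
    (nonneg_and_minimizers_eq_of_nonempty ⟨0, h0⟩).2.symm⟩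

/-- If `v` and `t • u - v` lie in `K` and `x u = 0`, then `x v` and `-x v` are both nonnegative, so
both points already lie in the face. -/
theorem minFace_sep_eq {K : Set V} {x : Module.Dual ℝ V} (hx : ∀ v ∈ K, 0 ≤ x v) {u : V}
    (hu : x u = 0) : minFace {v | v ∈ K ∧ x v = 0} u = minFace K u := by
  ext v
  constructor
  · rintro ⟨hv, t, ht, htv⟩
    exact ⟨hv.1, t, ht, htv.1⟩
  · rintro ⟨hv, t, ht, htv⟩
    have h1 := hx v hv
    have h2 := hx _ htv
    simp only [map_sub, map_smul, hu, smul_zero, zero_sub] at h2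
    have h3 : x v = 0 := by linarith
    exact ⟨⟨hv, h3⟩, t, ht, htv, by simp [hu, h3]⟩

-- The face is exposed by minus the sum of the forms in `S` that vanish at `u`.
open Filter in
theorem isFaceOf_minFace {S : Set (Module.Dual ℝ V)} (hS : S.Finite) {u : V}
    (hu : u ∈ polarCone S) : IsFaceOf (minFace (polarCone S) u) (polarCone S) := by
  classical
  set Z := hS.toFinset.filter (fun f => f u = 0) with hZ
  have hZS : ∀ f ∈ Z, f ∈ S ∧ f u = 0 := fun f hf => by simpa [hZ] using hf
  have hval : ∀ v : V, (-∑ f ∈ Z, f) v = ∑ f ∈ Z, -f v := fun v => by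
    simp [LinearMap.sum_apply]
  have hnn : ∀ v ∈ polarCone S, ∀ f ∈ Z, 0 ≤ -f v := fun v hv f hf =>
    neg_nonneg.2 (hv f (hZS f hf).1)
  convert isFaceOf_polarCone (x := -∑ f ∈ Z, f)
    (fun v hv => by rw [hval]; exact Finset.sum_nonneg (hnn v hv)) using 1
  ext v
  simp only [minFace, Set.mem_ofPred_eq]
  refine and_congr_right fun hv => ?_
  rw [hval, Finset.sum_eq_zero_iff_of_nonneg (hnn v hv)]
  constructor
  · rintro ⟨t, -, h⟩ f hf
    have := h f (hZS f hf).1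
    simp only [map_sub, map_smul, (hZS f hf).2, smul_zero, zero_sub] at this
    exact le_antisymm this (hnn v hv f hf)
  · intro h
    -- Forms that do not vanish at `u` are strictly negative there, so a large multiple of `u`
    -- absorbs `v`.
    have key : ∀ᶠ t : ℝ in atTop, ∀ f ∈ S, f (t • u - v) ≤ 0 := by
      rw [eventually_all_finite hS]
      intro f hf
      simp only [map_sub, map_smul, smul_eq_mul]
      rcases (hu f hf).eq_or_lt with h0 | h0
      · have := h f (by simp [hZ, hf, h0])
        exact Eventually.of_forall fun t => by rw [h0]; linarith
      · have : Tendsto (fun t : ℝ => t * f u) atTop atBot :=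
          tendsto_id.atTop_mul_const_of_neg h0
        filter_upwards [this.eventually_le_atBot (f v)] with t ht
        linarith
    obtain ⟨t, ht, ht0⟩ := (key.and (eventually_ge_atTop 0)).exists
    exact ⟨t, ht0, ht⟩

/-- A finitely generated cone has a point that dominates all others up to scaling. -/
theorem exists_minFace_eq_self {K : Set V} (hK : IsConvexPolyhedralCone K) :
    ∃ u ∈ K, K ⊆ minFace K u := by
  obtain ⟨T, hT, rfl⟩ := hK
  classical
  -- The sum of the generators is a relative interior point: subtracting any one generator leaves a
  -- point of the cone.
  refine ⟨∑ t ∈ hT.toFinset, t,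
    sum_mem fun t ht => Submodule.subset_span (hT.mem_toFinset.1 ht), fun v hv => ⟨hv, ?_⟩⟩
  induction hv using Submodule.span_induction with
  | zero => exact ⟨0, le_rfl, by simp⟩
  | add x y _ _ hx hy =>
    obtain ⟨s, hs, hs'⟩ := hx
    obtain ⟨t, ht, ht'⟩ := hy
    refine ⟨s + t, add_nonneg hs ht, ?_⟩
    rw [SetLike.mem_coe]
    convert add_mem hs' ht' using 1
    module
  | smul c x _ hx =>
    obtain ⟨s, hs, hs'⟩ := hx
    refine ⟨c * s, mul_nonneg c.2 hs, ?_⟩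
    rw [SetLike.mem_coe]
    convert PointedCone.smul_mem _ c.2 hs' using 1
    rw [← Nonneg.coe_smul]
    module
  | mem x hx =>
    refine ⟨1, zero_le_one, ?_⟩
    rw [one_smul, ← Finset.sum_erase_add _ _ (hT.mem_toFinset.2 hx), add_sub_cancel_right]
    exact sum_mem fun t ht =>
      Submodule.subset_span (hT.mem_toFinset.1 (Finset.mem_of_mem_erase ht))

theorem minFace_mono {K K' : Set V} (h : K ⊆ K') (u : V) : minFace K u ⊆ minFace K' u :=
  fun _ hv => ⟨h hv.1, hv.2.imp fun _ ht => ⟨ht.1, h ht.2⟩⟩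

/-- Cones whose smallest faces agree on common points intersect in a common face. -/
theorem isFaceOf_inter_of_minFace_eq [FiniteDimensional ℝ V] {S T : Set (Module.Dual ℝ V)}
    (hS : S.Finite) (hT : T.Finite)
    (h : ∀ u ∈ polarCone S ∩ polarCone T, minFace (polarCone S) u = minFace (polarCone T) u) :
    IsFaceOf (polarCone S ∩ polarCone T) (polarCone S) ∧
      IsFaceOf (polarCone S ∩ polarCone T) (polarCone T) := by
  have hK := isConvexPolyhedralCone_polarCone (hS.union hT)
  rw [polarCone_union] at hK
  obtain ⟨u, hu, hsub⟩ := exists_minFace_eq_self hK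
  have h1 : polarCone S ∩ polarCone T = minFace (polarCone S) u :=
    Set.Subset.antisymm (hsub.trans (minFace_mono Set.inter_subset_left u)) fun v hv =>
      ⟨hv.1, (h u hu ▸ hv : v ∈ minFace (polarCone T) u).1⟩
  have h2 : polarCone S ∩ polarCone T = minFace (polarCone T) u := h1.trans (h u hu)
  exact ⟨h1 ▸ isFaceOf_minFace hS hu.1, h2 ▸ isFaceOf_minFace hT hu.2⟩

/-- A criterion for a finite collection of cones given by inequalities to be a conic complex. -/
theorem isConicComplex_of_minFace_eq [FiniteDimensional ℝ V] {D : Set (Set V)}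
    (hne : D.Nonempty) (hfin : D.Finite)
    (hD : ∀ K ∈ D, ∃ S : Set (Module.Dual ℝ V), S.Finite ∧ K = polarCone S)
    (hface : ∀ K ∈ D, ∀ F : Set V, IsFaceOf F K → F ∈ D)
    (hmin : ∀ K ∈ D, ∀ K' ∈ D, ∀ u ∈ K ∩ K', minFace K u = minFace K' u) :
    IsConicComplex D := by
  refine ⟨⟨hne, hfin, ?_, ?_, hface, ?_⟩, ?_⟩
  · intro K hK
    obtain ⟨S, hS, rfl⟩ := hD K hK
    exact isPolyhedron_polarCone hS
  · intro K hK
    obtain ⟨S, -, rfl⟩ := hD K hK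
    exact ⟨0, zero_mem_polarCone S⟩
  · intro K hK K' hK'
    obtain ⟨S, hS, rfl⟩ := hD K hK
    obtain ⟨T, hT, rfl⟩ := hD K' hK'
    exact Or.inr (isFaceOf_inter_of_minFace_eq hS hT (hmin _ hK _ hK'))
  · intro K hK
    obtain ⟨S, hS, rfl⟩ := hD K hK
    exact isConvexPolyhedralCone_polarCone hS

end MinFace

/-! ### Recession cones, homogenization and faces of polyhedra. -/

section Recession

open Filter

theorem map_nonpos_of_frequently {H : Set (Module.Dual ℝ V × ℝ)} {p u : V}
    (h : ∃ᶠ r : ℝ in atTop, p + r • u ∈ polyhedronOf H) {k : Module.Dual ℝ V × ℝ} (hk : k ∈ H) :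
    k.1 u ≤ 0 :=
  slope_nonpos_of_frequently_le (a := k.1 p) (b := k.2) <|
    h.mono fun r hr => by simpa using hr k hk

/-- The recession cone of a non-empty polyhedron is cut out by the linear parts of its defining
inequalities. -/
theorem recCone_polyhedronOf {H : Set (Module.Dual ℝ V × ℝ)} (hne : (polyhedronOf H).Nonempty) :
    recCone (polyhedronOf H) = polarCone (Prod.fst '' H) := by
  ext u
  constructor
  · rintro hu _ ⟨k, hk, rfl⟩
    obtain ⟨p, hp⟩ := hne
    exact map_nonpos_of_frequently
      (((eventually_ge_atTop 0).mono fun r hr => hu p hp r hr).frequently) hk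
  · intro hu p hp r hr k hk
    have h1 := hp k hk
    have h2 := mul_nonpos_of_nonneg_of_nonpos hr (hu k.1 ⟨k, hk, rfl⟩)
    simp only [map_add, map_smul, smul_eq_mul]
    linarith

/-- Only frequent membership is assumed, since that is what the pigeonhole principle gives for a ray
in a finite union. -/
theorem mem_recCone_of_frequently {H : Set (Module.Dual ℝ V × ℝ)} {p u : V}
    (h : ∃ᶠ r : ℝ in atTop, p + r • u ∈ polyhedronOf H) : u ∈ recCone (polyhedronOf H) := by
  obtain ⟨r, hr⟩ := h.exists
  rw [recCone_polyhedronOf ⟨_, hr⟩]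
  rintro _ ⟨k, hk, rfl⟩
  exact map_nonpos_of_frequently h hk

theorem eventually_mem_of_frequently {P : Set V} {p u : V} (hu : u ∈ recCone P)
    (h : ∃ᶠ r : ℝ in atTop, p + r • u ∈ P) : ∀ᶠ r : ℝ in atTop, p + r • u ∈ P := by
  obtain ⟨r, hr⟩ := h.exists
  filter_upwards [eventually_ge_atTop r] with s hs
  convert hu _ hr (s - r) (sub_nonneg.2 hs) using 1
  module

/-- The linear forms on `V × ℝ` that define the cone over `polyhedronOf H`. -/
def homogenize (H : Set (Module.Dual ℝ V × ℝ)) : Set (Module.Dual ℝ (V × ℝ)) :=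
  insert (-LinearMap.snd ℝ V ℝ)
    ((fun k : Module.Dual ℝ V × ℝ =>
      k.1 ∘ₗ LinearMap.fst ℝ V ℝ - k.2 • LinearMap.snd ℝ V ℝ) '' H)

theorem finite_homogenize {H : Set (Module.Dual ℝ V × ℝ)} (hH : H.Finite) :
    (homogenize H).Finite := (hH.image _).insert _

theorem mem_polarCone_homogenize {H : Set (Module.Dual ℝ V × ℝ)} {w : V × ℝ} :
    w ∈ polarCone (homogenize H) ↔ 0 ≤ w.2 ∧ ∀ k ∈ H, k.1 w.1 ≤ k.2 * w.2 := by
  rw [homogenize, mem_polarCone_insert]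
  refine and_congr (by simp) (Set.forall_mem_image.trans (forall₂_congr fun k _ => ?_))
  simp

theorem mk_one_mem_polarCone_homogenize {H : Set (Module.Dual ℝ V × ℝ)} {p : V} :
    (p, (1 : ℝ)) ∈ polarCone (homogenize H) ↔ p ∈ polyhedronOf H := by
  simp [mem_polarCone_homogenize, polyhedronOf]

theorem mk_zero_mem_polarCone_homogenize {H : Set (Module.Dual ℝ V × ℝ)} {u : V} :
    (u, (0 : ℝ)) ∈ polarCone (homogenize H) ↔ u ∈ polarCone (Prod.fst '' H) := by
  rw [mem_polarCone_homogenize]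
  refine (and_iff_right le_rfl).trans (Iff.trans (forall₂_congr fun k _ => ?_)
    Set.forall_mem_image.symm)
  simp

theorem inv_smul_mem_polyhedronOf {H : Set (Module.Dual ℝ V × ℝ)} {w : V × ℝ}
    (hw : w ∈ polarCone (homogenize H)) (hpos : 0 < w.2) :
    w.2⁻¹ • w.1 ∈ polyhedronOf H := by
  rw [← mk_one_mem_polarCone_homogenize]
  convert smul_mem_polarCone (inv_nonneg.2 hpos.le) hw using 1
  ext <;> simp [hpos.ne']

/-- A linear form that is nonnegative on the recession cone of a non-empty polyhedron attains its
minimum on the polyhedron. -/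
theorem minimizers_nonempty [FiniteDimensional ℝ V] {H : Set (Module.Dual ℝ V × ℝ)}
    (hH : H.Finite) (hne : (polyhedronOf H).Nonempty) {x : Module.Dual ℝ V}
    (hx : ∀ u ∈ polarCone (Prod.fst '' H), 0 ≤ x u) :
    (minimizers (polyhedronOf H) x).Nonempty := by
  obtain ⟨T, hT, hK⟩ := isConvexPolyhedralCone_polarCone (finite_homogenize hH)
  have hTK : ∀ t ∈ T, t ∈ polarCone (homogenize H) := fun t ht => by
    rw [hK]; exact Submodule.subset_span ht
  have hT0 : ∀ t ∈ T, 0 ≤ t.2 := fun t ht => (mem_polarCone_homogenize.1 (hTK t ht)).1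
  have hpos : {t ∈ T | 0 < t.2}.Nonempty := by
    by_contra! hemp
    obtain ⟨p, hp⟩ := hne
    have h1 : (p, (1 : ℝ)) ∈ PointedCone.hull ℝ T := by
      rw [← SetLike.mem_coe, ← hK]; exact mk_one_mem_polarCone_homogenize.2 hp
    have h2 : LinearMap.snd ℝ V ℝ (p, (1 : ℝ)) ≤ 0 := map_nonpos_of_mem_hull (fun t ht => by
      by_contra! h
      have : t ∈ ({t ∈ T | 0 < t.2} : Set (V × ℝ)) := ⟨ht, h⟩
      simp [hemp] at this) h1
    simp at h2
    linarith
  -- Generators of positive height rescale to points of the polyhedron; the best of these finitely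
  -- many points is the minimizer.
  obtain ⟨t, ⟨htT, ht⟩, hmin⟩ :=
    Set.exists_min_image _ (fun t : V × ℝ => x (t.2⁻¹ • t.1)) (hT.sep _) hpos
  refine ⟨t.2⁻¹ • t.1, inv_smul_mem_polyhedronOf (hTK t htT) ht, fun q hq => ?_⟩
  set m := x (t.2⁻¹ • t.1)
  have hq1 : (q, (1 : ℝ)) ∈ PointedCone.hull ℝ T := by
    rw [← SetLike.mem_coe, ← hK]; exact mk_one_mem_polarCone_homogenize.2 hq
  -- The form `(v, s) ↦ m * s - x v` is checked on generators: at height zero by `hx`, at positive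
  -- height by the choice of `m`. Its value at `(q, 1)` gives `m ≤ x q`.
  have key := map_nonpos_of_mem_hull
    (f := m • LinearMap.snd ℝ V ℝ - x ∘ₗ LinearMap.fst ℝ V ℝ) (fun s hs => ?_) hq1
  · simpa using key
  · rcases (hT0 s hs).eq_or_lt with h0 | h0
    · have : (s.1, (0 : ℝ)) ∈ polarCone (homogenize H) := by
        convert hTK s hs using 1; exact Prod.ext rfl h0
      have := hx _ (mk_zero_mem_polarCone_homogenize.1 this)
      simpa [← h0] using this
    · have := hmin s ⟨hs, h0⟩
      simp only [map_smul, smul_eq_mul] at this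
      rw [inv_mul_eq_div, le_div_iff₀ h0] at this
      simpa using this

/-- One extra inequality suffices, the reverse one being minimality of `p`. Thus formulas for
polyhedra apply to faces. -/
theorem minimizers_eq_polyhedronOf {H : Set (Module.Dual ℝ V × ℝ)} {x : Module.Dual ℝ V}
    {p : V} (hp : p ∈ minimizers (polyhedronOf H) x) :
    minimizers (polyhedronOf H) x = polyhedronOf (insert (x, x p) H) := by
  ext v
  simp only [minimizers, polyhedronOf, Set.forall_mem_insert, Set.mem_ofPred_eq]
  constructor
  · rintro ⟨hv, h⟩
    exact ⟨h p hp.1, hv⟩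
  · rintro ⟨h, hv⟩
    exact ⟨hv, fun w hw => h.trans (hp.2 w hw)⟩

theorem recCone_minimizers {H : Set (Module.Dual ℝ V × ℝ)} {x : Module.Dual ℝ V}
    (hne : (minimizers (polyhedronOf H) x).Nonempty) :
    (∀ u ∈ recCone (polyhedronOf H), 0 ≤ x u) ∧
      recCone (minimizers (polyhedronOf H) x) = {u | u ∈ recCone (polyhedronOf H) ∧ x u = 0} := by
  obtain ⟨p, hp⟩ := hne
  have hnn : ∀ u ∈ recCone (polyhedronOf H), 0 ≤ x u := fun u hu => by
    have := hp.2 _ (hu p hp.1 1 zero_le_one)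
    simpa using this
  refine ⟨hnn, ?_⟩
  have hne' : (polyhedronOf (insert (x, x p) H)).Nonempty :=
    ⟨p, minimizers_eq_polyhedronOf hp ▸ hp⟩
  rw [minimizers_eq_polyhedronOf hp, recCone_polyhedronOf hne', Set.image_insert_eq]
  ext u
  rw [mem_polarCone_insert, ← recCone_polyhedronOf ⟨p, hp.1⟩]
  constructor
  · rintro ⟨h1, h2⟩
    exact ⟨h2, le_antisymm h1 (hnn u h2)⟩
  · rintro ⟨h1, h2⟩
    exact ⟨h2.le, h1⟩

theorem exists_polarCone_eq_recCone {P : Set V} (hP : IsPolyhedron P) (hne : P.Nonempty) :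
    ∃ S : Set (Module.Dual ℝ V), S.Finite ∧ recCone P = polarCone S := by
  obtain ⟨H, hH, rfl⟩ := hP
  exact ⟨_, hH.image _, recCone_polyhedronOf hne⟩

/-- The faces of the recession cone of a polyhedron are the recession cones of its faces. -/
theorem exists_face_of_isFaceOf_recCone [FiniteDimensional ℝ V] {P : Set V} (hP : IsPolyhedron P)
    (hne : P.Nonempty) {F : Set V} (hF : IsFaceOf F (recCone P)) :
    ∃ G, IsFaceOf G P ∧ recCone G = F := by
  obtain ⟨H, hH, rfl⟩ := hP
  change (polyhedronOf H).Nonempty at hne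
  change IsFaceOf F (recCone (polyhedronOf H)) at hF
  obtain ⟨hFne, x, rfl⟩ := hF
  rw [recCone_polyhedronOf hne] at hFne
  obtain ⟨hnn, heq⟩ := nonneg_and_minimizers_eq_of_nonempty hFne
  have hmin := minimizers_nonempty hH hne hnn
  refine ⟨_, ⟨hmin, x, rfl⟩, ?_⟩
  rw [(recCone_minimizers hmin).2, recCone_polyhedronOf hne, heq]

theorem minFace_recCone_of_isFaceOf {P G : Set V} (hP : IsPolyhedron P) (hG : IsFaceOf G P)
    {u : V} (hu : u ∈ recCone G) : minFace (recCone G) u = minFace (recCone P) u := by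
  obtain ⟨H, -, rfl⟩ := hP
  obtain ⟨hne, x, rfl⟩ := hG
  obtain ⟨hnn, heq⟩ := recCone_minimizers (H := H) hne
  change recCone (minimizers (polyhedronOf H) x) = _ at heq
  change u ∈ recCone (minimizers (polyhedronOf H) x) at hu
  rw [heq] at hu
  change minFace (recCone (minimizers (polyhedronOf H) x)) u = minFace (recCone (polyhedronOf H)) u
  rw [heq, minFace_sep_eq hnn hu.2]

theorem containsNoLine_of_line_direction {H : Set (Module.Dual ℝ V × ℝ)} {v : V}
    (hne : (polyhedronOf H).Nonempty) (h : ContainsNoLine (polyhedronOf H))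
    (hv : ∀ k ∈ H, k.1 v = 0) : v = 0 := by
  by_contra hv0
  obtain ⟨p, hp⟩ := hne
  refine h ⟨p, v, hv0, fun t k hk => ?_⟩
  simpa [hv k hk] using hp k hk

theorem containsNoLine_recCone {P : Set V} (hP : IsPolyhedron P) (hne : P.Nonempty)
    (h : ContainsNoLine P) : ContainsNoLine (recCone P) := by
  obtain ⟨H, -, rfl⟩ := hP
  rintro ⟨p, v, hv, hline⟩
  change ∀ t : ℝ, p + t • v ∈ recCone (polyhedronOf H) at hline
  rw [recCone_polyhedronOf hne] at hline
  exact hv (containsNoLine_of_line_direction hne h fun k hk =>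
    eq_zero_of_line_mem_polarCone hline ⟨k, hk, rfl⟩)

theorem isRationalPolyhedron_recCone {L : Submodule ℤ V} {P : Set V} (hne : P.Nonempty)
    (h : IsRationalPolyhedron L P) : IsRationalPolyhedron L (recCone P) := by
  obtain ⟨H, hH, hrat, rfl⟩ := h
  have := isRationalPolyhedron_polarCone (L := L) (hH.image Prod.fst) (by
    rintro _ ⟨k, hk, rfl⟩
    exact (hrat k hk).1)
  rwa [← recCone_polyhedronOf hne] at this

theorem exists_rat_of_mem_homogenize {L : Submodule ℤ V} {H : Set (Module.Dual ℝ V × ℝ)}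
    (hrat : ∀ h ∈ H, (∀ l ∈ L, ∃ q : ℚ, h.1 l = (q : ℝ)) ∧ ∃ q : ℚ, h.2 = (q : ℝ))
    {f : Module.Dual ℝ (V × ℝ)} (hf : f ∈ homogenize H) {l : V × ℝ}
    (hl : l ∈ latticeProdInt L) : ∃ q : ℚ, f l = (q : ℝ) := by
  obtain ⟨hl1, hl2⟩ := hl
  obtain ⟨n, hn⟩ := Submodule.mem_span_singleton.1 hl2
  have hn' : l.2 = (n : ℝ) := by simpa using hn.symm
  rcases hf with rfl | ⟨k, hk, rfl⟩
  · exact ⟨-n, by simp [hn']⟩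
  · obtain ⟨q, hq⟩ := (hrat k hk).1 l.1 hl1
    obtain ⟨b, hb⟩ := (hrat k hk).2
    exact ⟨q - b * n, by simp [hq, hb, hn']⟩

theorem prod_zero_eq_polarCone (H : Set (Module.Dual ℝ V × ℝ)) :
    polarCone (Prod.fst '' H) ×ˢ ({0} : Set ℝ) =
      polarCone (insert (LinearMap.snd ℝ V ℝ) (homogenize H)) := by
  ext ⟨u, s⟩
  rw [mem_polarCone_insert, Set.mem_prod, Set.mem_singleton_iff]
  constructor
  · rintro ⟨hu, hs : s = 0⟩
    subst hs
    exact ⟨by simp, mk_zero_mem_polarCone_homogenize.2 hu⟩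
  · rintro ⟨hs, hw⟩
    have : s = 0 := le_antisymm hs (mem_polarCone_homogenize.1 hw).1
    subst this
    exact ⟨mk_zero_mem_polarCone_homogenize.1 hw, rfl⟩

theorem minFace_prod_zero (K : Set V) (u : V) :
    minFace (K ×ˢ ({0} : Set ℝ)) (u, 0) = minFace K u ×ˢ ({0} : Set ℝ) := by
  ext ⟨v, s⟩
  simp only [minFace, Set.mem_ofPred_eq, Set.mem_prod, Set.mem_singleton_iff]
  constructor
  · rintro ⟨⟨hv, hs⟩, t, ht, h, -⟩
    exact ⟨⟨hv, t, ht, by simpa using h⟩, hs⟩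
  · rintro ⟨⟨hv, t, ht, h⟩, hs⟩
    exact ⟨⟨hv, hs⟩, t, ht, by simpa using h, by simp [hs]⟩

end Recession

end Cones

/-! ### Closedness, asymptotic rays and the recession complex. -/

section Topological

open Filter Topology

variable {V : Type*} [NormedAddCommGroup V] [NormedSpace ℝ V]

/-- A point `w` of the closed cone is the limit of `w + ε • (p, 1)`, which has positive height and
hence is a positive multiple of a point of the polyhedron at height one. -/
theorem coneOver_polyhedronOf [FiniteDimensional ℝ V] {H : Set (Module.Dual ℝ V × ℝ)}
    (hne : (polyhedronOf H).Nonempty) :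
    coneOver (polyhedronOf H) = polarCone (homogenize H) := by
  apply Set.Subset.antisymm
  · refine closure_minimal ?_ ?_
    · rintro _ ⟨c, hc, ⟨p, s⟩, ⟨hp, hs : s = 1⟩, rfl⟩
      subst hs
      exact smul_mem_polarCone (le_of_lt hc) (mk_one_mem_polarCone_homogenize.2 hp)
    · have : polarCone (homogenize H) = ⋂ f ∈ homogenize H, {w | f w ≤ 0} := by
        ext; simp [polarCone]
      rw [this]
      exact isClosed_biInter fun f _ =>
        isClosed_le f.continuous_of_finiteDimensional continuous_const
  · intro w hw
    obtain ⟨p, hp⟩ := hne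
    have hlim : Tendsto (fun ε : ℝ => w + ε • (p, (1 : ℝ))) (𝓝[>] 0) (𝓝 w) := by
      have : Tendsto (fun ε : ℝ => w + ε • (p, (1 : ℝ))) (𝓝 0) (𝓝 (w + (0 : ℝ) • (p, (1 : ℝ)))) :=
        Continuous.tendsto (by fun_prop) 0
      rw [zero_smul, add_zero] at this
      exact this.mono_left nhdsWithin_le_nhds
    refine mem_closure_of_tendsto hlim ?_
    filter_upwards [self_mem_nhdsWithin] with ε hε
    have hmem : w + ε • (p, (1 : ℝ)) ∈ polarCone (homogenize H) :=
      add_mem_polarCone hw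
        (smul_mem_polarCone (le_of_lt hε) (mk_one_mem_polarCone_homogenize.2 hp))
    have hpos : 0 < (w + ε • (p, (1 : ℝ))).2 := by
      have h1 := (mem_polarCone_homogenize.1 hw).1
      have h2 : 0 < ε := hε
      simp only [Prod.snd_add, Prod.smul_snd, smul_eq_mul, mul_one]
      linarith
    set z := w + ε • (p, (1 : ℝ))
    refine ⟨z.2, hpos, (z.2⁻¹ • z.1, 1), ⟨inv_smul_mem_polyhedronOf hmem hpos, rfl⟩, ?_⟩
    ext <;> simp [hpos.ne']

theorem isClosed_of_isPolyhedron [FiniteDimensional ℝ V] {P : Set V} (hP : IsPolyhedron P) :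
    IsClosed P := by
  obtain ⟨H, -, rfl⟩ := hP
  have : {u : V | ∀ h ∈ H, h.1 u ≤ h.2} = ⋂ h ∈ H, {u | h.1 u ≤ h.2} := by ext; simp
  rw [this]
  exact isClosed_biInter fun h _ =>
    isClosed_le h.1.continuous_of_finiteDimensional continuous_const

/-- The points whose ray in direction `u` eventually lies in `P`. -/
def asymptoticSet (P : Set V) (u : V) : Set V := {p | ∀ᶠ r : ℝ in atTop, p + r • u ∈ P}

/-- Along the ray, a constraint `h` with `h.1 u = 0` is a closed condition on `p` alone, and one
with `h.1 u < 0` eventually holds for every `p`. -/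
theorem isClosed_asymptoticSet [FiniteDimensional ℝ V] {P : Set V} (hP : IsPolyhedron P) {u : V}
    (hne : P.Nonempty) (hu : u ∈ recCone P) : IsClosed (asymptoticSet P u) := by
  obtain ⟨H, hH, rfl⟩ := hP
  change u ∈ recCone (polyhedronOf H) at hu
  rw [recCone_polyhedronOf hne] at hu
  have : asymptoticSet {u : V | ∀ h ∈ H, h.1 u ≤ h.2} u =
      ⋂ h ∈ H, {p | ∀ᶠ r : ℝ in atTop, h.1 (p + r • u) ≤ h.2} := by
    ext p
    simp only [asymptoticSet, Set.mem_ofPred_eq, Set.mem_iInter, eventually_all_finite hH]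
  rw [this]
  refine isClosed_biInter fun (h : Module.Dual ℝ V × ℝ) hh => ?_
  have hval : ∀ (p : V) (r : ℝ), h.1 (p + r • u) = h.1 p + r * h.1 u := fun p r => by simp
  simp_rw [hval]
  rcases (hu h.1 ⟨h, hh, rfl⟩).eq_or_lt with h0 | h0
  · simp only [h0, mul_zero, add_zero, eventually_const]
    exact isClosed_le h.1.continuous_of_finiteDimensional continuous_const
  · convert isClosed_univ
    refine Set.eq_univ_of_forall fun p => ?_
    have : Tendsto (fun r : ℝ => r * h.1 u) atTop atBot := tendsto_id.atTop_mul_const_of_neg h0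
    filter_upwards [this.eventually_le_atBot (h.2 - h.1 p)] with r hr
    linarith

/-- A ray contained in a finite union of polyhedra eventually lies in one of them. -/
theorem exists_mem_asymptoticSet {C : Set (Set V)} (hfin : C.Finite)
    (hpoly : ∀ P ∈ C, IsPolyhedron P) {p u : V} (hray : ∀ r : ℝ, 0 ≤ r → p + r • u ∈ ⋃₀ C) :
    ∃ P ∈ C, u ∈ recCone P ∧ p ∈ asymptoticSet P u := by
  have : ∃ P ∈ C, ∃ᶠ r : ℝ in atTop, p + r • u ∈ P := by
    by_contra! h
    rw [← eventually_all_finite hfin] at h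
    obtain ⟨r, hr, hr0⟩ := (h.and (eventually_ge_atTop 0)).exists
    obtain ⟨P, hP, hmem⟩ := hray r hr0
    exact hr P hP hmem
  obtain ⟨P, hP, h⟩ := this
  obtain ⟨H, -, hPH⟩ := hpoly P hP
  have hu : u ∈ recCone P := by
    change P = polyhedronOf H at hPH
    rw [hPH] at h ⊢
    exact mem_recCone_of_frequently h
  exact ⟨P, hP, hu, eventually_mem_of_frequently hu h⟩

/-- Under the Minkowski–Weyl condition, a direction in which one ray stays in a closed set is a
recession direction of the set. -/
theorem mem_recCone_of_ray {E : Set V} (hMW : MinkowskiWeylCondition E) (hE : IsClosed E)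
    {p u : V} (hray : ∀ r : ℝ, 0 ≤ r → p + r • u ∈ E) : u ∈ recCone E := by
  obtain ⟨D, σ, hD, hpoly, ⟨T, -, hσ⟩, rfl⟩ := hMW
  have hbdd : Bornology.IsBounded (⋃₀ D) := by
    refine (Bornology.isBounded_sUnion hD).2 fun K hK => ?_
    obtain ⟨s, hs, rfl⟩ := hpoly K hK
    exact isBounded_convexHull.2 hs.isBounded
  obtain ⟨M, hM⟩ := hbdd.exists_norm_le
  -- Since `d n` stays bounded, `s n / n = u + (p - d n) / n` tends to `u`. Adding `r / n` times `s
  -- n` to a point of `E` stays in `E`, and closedness of `E` gives the limit without needing `σ`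
  -- closed.
  have hdec : ∀ n : ℕ, ∃ d ∈ ⋃₀ D, ∃ s ∈ σ, d + s = p + (n : ℝ) • u := fun n =>
    hray n n.cast_nonneg
  choose d hd s hs hds using hdec
  have hv : Tendsto (fun n : ℕ => (n : ℝ)⁻¹ • (p - d n)) atTop (𝓝 0) := by
    refine squeeze_zero_norm (a := fun n : ℕ => (n : ℝ)⁻¹ * (‖p‖ + M)) (fun n => ?_) ?_
    · rw [norm_smul, norm_inv, RCLike.norm_natCast]
      exact mul_le_mul_of_nonneg_left ((norm_sub_le _ _).trans (by linarith [hM _ (hd n)]))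
        (by positivity)
    · simpa using (tendsto_inv_atTop_nhds_zero_nat (𝕜 := ℝ)).mul_const (‖p‖ + M)
  intro q hq r hr
  have hlim : Tendsto (fun n : ℕ => q + r • (u + (n : ℝ)⁻¹ • (p - d n))) atTop
      (𝓝 (q + r • u)) := by
    have := (tendsto_const_nhds (x := q)).add (((tendsto_const_nhds (x := u)).add hv).const_smul r)
    rwa [add_zero] at this
  refine hE.mem_of_tendsto hlim ?_
  filter_upwards [eventually_ge_atTop 1] with n hn
  have hn0 : (n : ℝ) ≠ 0 := by positivity
  obtain ⟨d', hd', s', hs', rfl⟩ := hq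
  refine ⟨d', hd', s' + (r * (n : ℝ)⁻¹) • s n, ?_, ?_⟩
  · subst hσ
    exact add_mem hs' (PointedCone.smul_mem _ (by positivity) (hs n))
  · have : s n = p + (n : ℝ) • u - d n := by rw [← hds n]; abel
    have hu : u = (n : ℝ)⁻¹ • (n : ℝ) • u := by rw [smul_smul, inv_mul_cancel₀ hn0, one_smul]
    simp only [this]
    conv_rhs => rw [hu]
    module

theorem isClosed_complexSupport [FiniteDimensional ℝ V] {C : Set (Set V)}
    (hC : IsPolyhedralComplex C) : IsClosed (complexSupport C) := by
  rw [complexSupport, Set.sUnion_eq_biUnion]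
  exact hC.finite.isClosed_biUnion fun P hP => isClosed_of_isPolyhedron (hC.isPolyhedron P hP)

/-- The smallest face of a recession cone through a direction `u` does not depend on the
polyhedron, provided the support is connected and `u` is a recession direction of it. -/
theorem minFace_recCone_eq [FiniteDimensional ℝ V] {C : Set (Set V)} (hC : IsPolyhedralComplex C)
    (hconn : IsPreconnected (complexSupport C)) {u : V}
    (hu : u ∈ recCone (complexSupport C)) {P Q : Set V} (hP : P ∈ C) (hQ : Q ∈ C)
    (huP : u ∈ recCone P) (huQ : u ∈ recCone Q) :
    minFace (recCone P) u = minFace (recCone Q) u := by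
  by_contra hPQ
  have hclosed : ∀ D ⊆ {R ∈ C | u ∈ recCone R}, IsClosed (⋃ R ∈ D, asymptoticSet R u) :=
    fun D hD => (hC.finite.subset fun R hR => (hD hR).1).isClosed_biUnion fun R hR =>
      isClosed_asymptoticSet (hC.isPolyhedron R (hD hR).1) (hC.nonempty_of_mem R (hD hR).1)
        (hD hR).2
  have hself : ∀ R ∈ C, u ∈ recCone R → ∃ p ∈ complexSupport C, p ∈ asymptoticSet R u := by
    intro R hR huR
    obtain ⟨p, hp⟩ := hC.nonempty_of_mem R hR
    exact ⟨p, ⟨R, hR, hp⟩, (eventually_ge_atTop 0).mono fun r hr => huR p hp r hr⟩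
  -- Members having `u` as recession direction, split by whether their smallest face through `u` is
  -- that of `P`.
  let A := {R | (R ∈ C ∧ u ∈ recCone R) ∧ minFace (recCone R) u = minFace (recCone P) u}
  let B := {R | (R ∈ C ∧ u ∈ recCone R) ∧ minFace (recCone R) u ≠ minFace (recCone P) u}
  obtain ⟨p, -, hpA, hpB⟩ := isPreconnected_closed_iff.1 hconn (⋃ R ∈ A, asymptoticSet R u)
    (⋃ R ∈ B, asymptoticSet R u) (hclosed A fun R hR => hR.1) (hclosed B fun R hR => hR.1)
    (fun p hp => by
      obtain ⟨R, hR, huR, hpR⟩ :=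
        exists_mem_asymptoticSet hC.finite hC.isPolyhedron fun r hr => hu p hp r hr
      by_cases h : minFace (recCone R) u = minFace (recCone P) u
      · exact Or.inl (Set.mem_biUnion (x := R) ⟨⟨hR, huR⟩, h⟩ hpR)
      · exact Or.inr (Set.mem_biUnion (x := R) ⟨⟨hR, huR⟩, h⟩ hpR))
    (by
      obtain ⟨p, hp, hpP⟩ := hself P hP huP
      exact ⟨p, hp, Set.mem_biUnion (x := P) ⟨⟨hP, huP⟩, rfl⟩ hpP⟩)
    (by
      obtain ⟨p, hp, hpQ⟩ := hself Q hQ huQ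
      exact ⟨p, hp, Set.mem_biUnion (x := Q) ⟨⟨hQ, huQ⟩, fun h => hPQ h.symm⟩ hpQ⟩)
  simp only [Set.mem_iUnion] at hpA hpB
  obtain ⟨R, ⟨⟨hR, huR⟩, hRP⟩, hpR⟩ := hpA
  obtain ⟨R', ⟨⟨hR', huR'⟩, hRP'⟩, hpR'⟩ := hpB
  obtain ⟨r, hr, hr'⟩ := (hpR.and hpR').exists
  -- The ray from `p` eventually lies in `R ∩ R'`, which is therefore a common face and has `u` as
  -- recession direction.
  have huI : u ∈ recCone (R ∩ R') := fun q hq t ht => ⟨huR q hq.1 t ht, huR' q hq.2 t ht⟩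
  rcases hC.inter_face R hR R' hR' with hdisj | ⟨h1, h2⟩
  · exact Set.disjoint_left.1 hdisj hr hr'
  · exact hRP' (by
      rw [← minFace_recCone_of_isFaceOf (hC.isPolyhedron R' hR') h2 huI,
        minFace_recCone_of_isFaceOf (hC.isPolyhedron R hR) h1 huI, hRP])

theorem complexSupport_recComplex [FiniteDimensional ℝ V] {C : Set (Set V)}
    (hC : IsPolyhedralComplex C) (hne : (complexSupport C).Nonempty)
    (hMW : MinkowskiWeylCondition (complexSupport C)) :
    complexSupport (recComplex C) = recCone (complexSupport C) := by
  ext u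
  constructor
  · rintro ⟨_, ⟨P, hP, rfl⟩, hu⟩
    obtain ⟨p, hp⟩ := hC.nonempty_of_mem P hP
    exact mem_recCone_of_ray hMW (isClosed_complexSupport hC) (p := p)
      fun r hr => ⟨P, hP, hu p hp r hr⟩
  · intro hu
    obtain ⟨p, hp⟩ := hne
    obtain ⟨P, hP, huP, -⟩ :=
      exists_mem_asymptoticSet hC.finite hC.isPolyhedron fun r hr => hu p hp r hr
    exact ⟨_, ⟨P, hP, rfl⟩, huP⟩

theorem recComplex_face_mem [FiniteDimensional ℝ V] {C : Set (Set V)}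
    (hC : IsPolyhedralComplex C) {P : Set V} (hP : P ∈ C) {F : Set V}
    (hF : IsFaceOf F (recCone P)) : F ∈ recComplex C := by
  obtain ⟨G, hG, rfl⟩ :=
    exists_face_of_isFaceOf_recCone (hC.isPolyhedron P hP) (hC.nonempty_of_mem P hP) hF
  exact ⟨G, hC.face_mem P hP G hG, rfl⟩

theorem isConicComplex_recComplex [FiniteDimensional ℝ V] {C : Set (Set V)}
    (hC : IsPolyhedralComplex C) (hconn : IsConnected (complexSupport C))
    (hMW : MinkowskiWeylCondition (complexSupport C)) : IsConicComplex (recComplex C) := by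
  refine isConicComplex_of_minFace_eq (hC.nonempty.image _) (hC.finite.image _) ?_ ?_ ?_
  · rintro _ ⟨P, hP, rfl⟩
    exact exists_polarCone_eq_recCone (hC.isPolyhedron P hP) (hC.nonempty_of_mem P hP)
  · rintro _ ⟨P, hP, rfl⟩ F hF
    exact recComplex_face_mem hC hP hF
  · rintro _ ⟨P, hP, rfl⟩ _ ⟨Q, hQ, rfl⟩ u ⟨huP, huQ⟩
    refine minFace_recCone_eq hC hconn.isPreconnected ?_ hP hQ huP huQ
    rw [← complexSupport_recComplex hC hconn.nonempty hMW]
    exact ⟨_, ⟨P, hP, rfl⟩, huP⟩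

theorem coneOver_snd_nonneg {E : Set V} {w : V × ℝ} (hw : w ∈ coneOver E) : 0 ≤ w.2 := by
  have : coneOver E ⊆ {w | 0 ≤ w.2} := by
    refine closure_minimal ?_ (isClosed_le continuous_const continuous_snd)
    rintro _ ⟨c, hc, ⟨p, s⟩, ⟨-, hs : s = 1⟩, rfl⟩
    subst hs
    simpa using le_of_lt hc
  exact this hw

theorem mem_coneOver_of_inv_smul_mem {E : Set V} {w : V × ℝ} (hpos : 0 < w.2)
    (hw : w.2⁻¹ • w.1 ∈ E) : w ∈ coneOver E :=
  subset_closure ⟨w.2, hpos, (w.2⁻¹ • w.1, 1), ⟨hw, rfl⟩, by ext <;> simp [hpos.ne']⟩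

theorem minimizers_prod_zero (K : Set V) (y : Module.Dual ℝ (V × ℝ)) :
    minimizers (K ×ˢ ({0} : Set ℝ)) y =
      minimizers K (y ∘ₗ LinearMap.inl ℝ V ℝ) ×ˢ ({0} : Set ℝ) := by
  ext ⟨u, s⟩
  constructor
  · rintro ⟨⟨hu, hs : s = 0⟩, h⟩
    subst hs
    exact ⟨⟨hu, fun v hv => h (v, 0) ⟨hv, rfl⟩⟩, rfl⟩
  · rintro ⟨⟨hu, h⟩, hs : s = 0⟩
    subst hs
    refine ⟨⟨hu, rfl⟩, ?_⟩
    rintro ⟨v, t⟩ ⟨hv, ht : t = 0⟩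
    subst ht
    exact h v hv

theorem coneOver_mono {E E' : Set V} (h : E ⊆ E') : coneOver E ⊆ coneOver E' :=
  closure_mono (Set.smul_subset_smul_left (Set.prod_mono h subset_rfl))

theorem isRationalPolyhedron_recCone_prod_zero {L : Submodule ℤ V} {P : Set V} (hne : P.Nonempty)
    (h : IsRationalPolyhedron L P) :
    IsRationalPolyhedron (latticeProdInt L) (recCone P ×ˢ ({0} : Set ℝ)) := by
  obtain ⟨H, hH, hrat, rfl⟩ := h
  have := isRationalPolyhedron_polarCone (L := latticeProdInt L)
    ((finite_homogenize hH).insert (LinearMap.snd ℝ V ℝ)) (by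
      rintro f (rfl | hf) l hl
      · obtain ⟨q, hq⟩ := exists_rat_of_mem_homogenize hrat (Set.mem_insert _ _) hl
        exact ⟨-q, by simpa [neg_eq_iff_eq_neg] using hq⟩
      · exact exists_rat_of_mem_homogenize hrat hf hl)
  rwa [← prod_zero_eq_polarCone, ← recCone_polyhedronOf hne] at this

theorem exists_polarCone_eq_recCone_prod_zero {P : Set V} (hP : IsPolyhedron P)
    (hne : P.Nonempty) :
    ∃ S : Set (Module.Dual ℝ (V × ℝ)), S.Finite ∧ recCone P ×ˢ ({0} : Set ℝ) = polarCone S := by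
  obtain ⟨H, hH, rfl⟩ := hP
  refine ⟨_, (finite_homogenize hH).insert (LinearMap.snd ℝ V ℝ), ?_⟩
  rw [← prod_zero_eq_polarCone, ← recCone_polyhedronOf hne]
  rfl

/-! ### The cone complex over a polyhedral complex. -/

section ConeOver

variable [FiniteDimensional ℝ V]

theorem mk_zero_mem_coneOver {P : Set V} (hP : IsPolyhedron P) (hne : P.Nonempty) {u : V} :
    (u, (0 : ℝ)) ∈ coneOver P ↔ u ∈ recCone P := by
  obtain ⟨H, -, rfl⟩ := hP
  change _ ∈ coneOver (polyhedronOf H) ↔ _ ∈ recCone (polyhedronOf H)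
  rw [coneOver_polyhedronOf hne, recCone_polyhedronOf hne, mk_zero_mem_polarCone_homogenize]

theorem mk_one_mem_coneOver {P : Set V} (hP : IsPolyhedron P) (hne : P.Nonempty) {u : V} :
    (u, (1 : ℝ)) ∈ coneOver P ↔ u ∈ P := by
  obtain ⟨H, -, rfl⟩ := hP
  change _ ∈ coneOver (polyhedronOf H) ↔ _ ∈ polyhedronOf H
  rw [coneOver_polyhedronOf hne, mk_one_mem_polarCone_homogenize]

theorem exists_polarCone_eq_coneOver {P : Set V} (hP : IsPolyhedron P) (hne : P.Nonempty) :
    ∃ S : Set (Module.Dual ℝ (V × ℝ)), S.Finite ∧ coneOver P = polarCone S := by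
  obtain ⟨H, hH, rfl⟩ := hP
  exact ⟨_, finite_homogenize hH, coneOver_polyhedronOf hne⟩

theorem smul_mem_coneOver {P : Set V} (hP : IsPolyhedron P) (hne : P.Nonempty) {w : V × ℝ} {c : ℝ}
    (hc : 0 ≤ c) (hw : w ∈ coneOver P) : c • w ∈ coneOver P := by
  obtain ⟨S, -, hS⟩ := exists_polarCone_eq_coneOver hP hne
  rw [hS] at hw ⊢
  exact smul_mem_polarCone hc hw

theorem inv_smul_mem_of_mem_coneOver {P : Set V} (hP : IsPolyhedron P) (hne : P.Nonempty)
    {w : V × ℝ} (hw : w ∈ coneOver P) (hpos : 0 < w.2) : w.2⁻¹ • w.1 ∈ P := by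
  rw [← mk_one_mem_coneOver hP hne]
  convert smul_mem_coneOver hP hne (inv_nonneg.2 hpos.le) hw using 1
  ext <;> simp [hpos.ne']

/-- The cone over a face of a polyhedron is a face of the cone over the polyhedron. -/
theorem coneOver_minimizers {P : Set V} (hP : IsPolyhedron P) {x : Module.Dual ℝ V} {p : V}
    (hp : p ∈ minimizers P x) :
    (∀ w ∈ coneOver P, 0 ≤ (x ∘ₗ LinearMap.fst ℝ V ℝ - x p • LinearMap.snd ℝ V ℝ) w) ∧
      coneOver (minimizers P x) =
        {w | w ∈ coneOver P ∧ (x ∘ₗ LinearMap.fst ℝ V ℝ - x p • LinearMap.snd ℝ V ℝ) w = 0} := by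
  set f : Module.Dual ℝ (V × ℝ) := x ∘ₗ LinearMap.fst ℝ V ℝ - x p • LinearMap.snd ℝ V ℝ with hf
  have hnn : ∀ w ∈ coneOver P, 0 ≤ f w := by
    have : coneOver P ⊆ {w | 0 ≤ f w} := by
      refine closure_minimal ?_ (isClosed_le continuous_const f.continuous_of_finiteDimensional)
      rintro _ ⟨c, hc, ⟨q, s⟩, ⟨hq, hs : s = 1⟩, rfl⟩
      subst hs
      have := hp.2 q hq
      change 0 ≤ f (c • (q, (1 : ℝ)))
      rw [map_smul]
      exact mul_nonneg (le_of_lt hc) (by simpa [hf] using this)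
    exact this
  refine ⟨hnn, ?_⟩
  obtain ⟨H, -, rfl⟩ := hP
  change p ∈ minimizers (polyhedronOf H) x at hp
  change ∀ w ∈ coneOver (polyhedronOf H), 0 ≤ f w at hnn
  change coneOver (minimizers (polyhedronOf H) x) = {w | w ∈ coneOver (polyhedronOf H) ∧ f w = 0}
  have hp' : p ∈ polyhedronOf (insert (x, x p) H) := minimizers_eq_polyhedronOf hp ▸ hp
  rw [minimizers_eq_polyhedronOf hp, coneOver_polyhedronOf ⟨p, hp'⟩]
  rw [coneOver_polyhedronOf ⟨p, hp.1⟩] at hnn ⊢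
  ext w
  have hfw : f w = x w.1 - x p * w.2 := by simp [hf]
  simp only [Set.mem_ofPred_eq, mem_polarCone_homogenize, Set.forall_mem_insert]
  constructor
  · rintro ⟨h0, h1, h2⟩
    exact ⟨⟨h0, h2⟩, le_antisymm (by linarith) (hnn w (mem_polarCone_homogenize.2 ⟨h0, h2⟩))⟩
  · rintro ⟨⟨h0, h2⟩, h1⟩
    exact ⟨h0, by linarith, h2⟩

theorem minFace_coneOver_of_isFaceOf {P G : Set V} (hP : IsPolyhedron P) (hG : IsFaceOf G P)
    {w : V × ℝ} (hw : w ∈ coneOver G) : minFace (coneOver G) w = minFace (coneOver P) w := by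
  obtain ⟨⟨p, hp⟩, x, rfl⟩ := hG
  obtain ⟨hnn, heq⟩ := coneOver_minimizers hP hp
  rw [heq] at hw ⊢
  exact minFace_sep_eq hnn hw.2

/-- Heights are nonnegative on the cone, while `v` and `t • (u, 0) - v` have opposite heights; so
both lie in the slice at height zero. -/
theorem minFace_coneOver_mk_zero {P : Set V} (hP : IsPolyhedron P) (hne : P.Nonempty) (u : V) :
    minFace (coneOver P) (u, 0) = minFace (recCone P) u ×ˢ ({0} : Set ℝ) := by
  rw [← minFace_prod_zero]
  refine Set.Subset.antisymm ?_ (minFace_mono ?_ _)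
  · rintro ⟨v, s⟩ ⟨hv, t, ht, h⟩
    have hs : s = 0 :=
      le_antisymm (by simpa using coneOver_snd_nonneg h) (coneOver_snd_nonneg hv)
    subst hs
    have h' : (t • u - v, (0 : ℝ)) ∈ coneOver P := by simpa using h
    exact ⟨⟨(mk_zero_mem_coneOver hP hne).1 hv, rfl⟩, t, ht,
      by simpa using (mk_zero_mem_coneOver hP hne).1 h', by simp⟩
  · rintro ⟨v, s⟩ ⟨hv, hs : s = 0⟩
    subst hs
    exact (mk_zero_mem_coneOver hP hne).2 hv

variable {C : Set (Set V)}

theorem coneComplex_face_mem_of_recCone_prod_zero (hC : IsPolyhedralComplex C) {P : Set V}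
    (hP : P ∈ C) {F : Set (V × ℝ)} (hF : IsFaceOf F (recCone P ×ˢ ({0} : Set ℝ))) :
    F ∈ coneComplex C := by
  obtain ⟨hne, y, rfl⟩ := hF
  rw [minimizers_prod_zero] at hne ⊢
  exact Or.inr ⟨_, recComplex_face_mem hC hP ⟨hne.fst, _, rfl⟩, rfl⟩

/-- A face reaching positive height is the cone over a face of `P`; any other lies in the slice at
height zero and is a face of `recCone P ×ˢ {0}`. -/
theorem coneComplex_face_mem_of_coneOver (hC : IsPolyhedralComplex C) {P : Set V}
    (hP : P ∈ C) {F : Set (V × ℝ)} (hF : IsFaceOf F (coneOver P)) : F ∈ coneComplex C := by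
  have hpoly := hC.isPolyhedron P hP
  have hPne := hC.nonempty_of_mem P hP
  obtain ⟨hne, y, rfl⟩ := hF
  obtain ⟨S, -, hS⟩ := exists_polarCone_eq_coneOver hpoly hPne
  obtain ⟨hnn, heq⟩ := nonneg_and_minimizers_eq_of_nonempty (hS ▸ hne)
  rw [← hS] at hnn heq
  set x := y ∘ₗ LinearMap.inl ℝ V ℝ with hx
  have hy : ∀ w : V × ℝ, y w = x w.1 + w.2 * y (0, 1) := fun w => by
    rw [hx, LinearMap.comp_apply, LinearMap.inl_apply, ← smul_eq_mul, ← map_smul, ← map_add]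
    simp
  by_cases h : ∃ w ∈ minimizers (coneOver P) y, 0 < w.2
  · obtain ⟨w, hw, hpos⟩ := h
    rw [heq] at hw
    have hpP := inv_smul_mem_of_mem_coneOver hpoly hPne hw.1 hpos
    have hxp : x (w.2⁻¹ • w.1) = -y (0, 1) := by
      have := hy w
      rw [hw.2] at this
      rw [map_smul, smul_eq_mul, inv_mul_eq_iff_eq_mul₀ hpos.ne']
      linarith
    have hp : w.2⁻¹ • w.1 ∈ minimizers P x := by
      refine ⟨hpP, fun q hq => ?_⟩
      have := hnn _ ((mk_one_mem_coneOver hpoly hPne).2 hq)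
      rw [hy] at this
      simp only [one_mul] at this
      linarith
    refine Or.inl ⟨minimizers P x, hC.face_mem P hP _ ⟨⟨_, hp⟩, x, rfl⟩, ?_⟩
    rw [(coneOver_minimizers hpoly hp).2, heq]
    ext v
    refine and_congr_right fun _ => ?_
    rw [hy v, hxp]
    simp [mul_comm]
  · push Not at h
    have : minimizers (coneOver P) y = minimizers (recCone P ×ˢ ({0} : Set ℝ)) y := by
      obtain ⟨w, hw⟩ := hne
      have hslice : recCone P ×ˢ ({0} : Set ℝ) ⊆ coneOver P := by
        rintro ⟨v, s⟩ ⟨hv, hs : s = 0⟩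
        subst hs
        exact (mk_zero_mem_coneOver hpoly hPne).2 hv
      have hdown : ∀ v ∈ minimizers (coneOver P) y, v ∈ recCone P ×ˢ ({0} : Set ℝ) := by
        rintro ⟨v, s⟩ hv
        have hs : s = 0 := le_antisymm (h _ hv) (coneOver_snd_nonneg hv.1)
        subst hs
        exact ⟨(mk_zero_mem_coneOver hpoly hPne).1 hv.1, rfl⟩
      ext v
      -- The minimizer `w` lies in the slice, so the minimum of `y` over the slice equals its
      -- minimum over the whole cone.
      exact ⟨fun hv => ⟨hdown v hv, fun z hz => hv.2 z (hslice hz)⟩, fun hv =>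
        ⟨hslice hv.1, fun z hz => (hv.2 w (hdown w hw)).trans (hw.2 z hz)⟩⟩
    rw [this] at hne ⊢
    exact coneComplex_face_mem_of_recCone_prod_zero hC hP ⟨hne, y, rfl⟩

theorem isConicComplex_coneComplex (hC : IsPolyhedralComplex C)
    (hconn : IsConnected (complexSupport C))
    (hMW : MinkowskiWeylCondition (complexSupport C)) : IsConicComplex (coneComplex C) := by
  have hpoly := hC.isPolyhedron
  have hne := hC.nonempty_of_mem
  have hrec : ∀ P ∈ C, ∀ Q ∈ C, ∀ u, u ∈ recCone P → u ∈ recCone Q →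
      minFace (recCone P) u = minFace (recCone Q) u := fun P hP Q hQ u huP huQ => by
    refine minFace_recCone_eq hC hconn.isPreconnected ?_ hP hQ huP huQ
    rw [← complexSupport_recComplex hC hconn.nonempty hMW]
    exact ⟨_, ⟨P, hP, rfl⟩, huP⟩
  refine isConicComplex_of_minFace_eq ((hC.nonempty.image _).inl)
    ((hC.finite.image _).union ((hC.finite.image _).image _)) ?_ ?_ ?_
  · rintro _ (⟨P, hP, rfl⟩ | ⟨_, ⟨P, hP, rfl⟩, rfl⟩)
    · exact exists_polarCone_eq_coneOver (hpoly P hP) (hne P hP)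
    · exact exists_polarCone_eq_recCone_prod_zero (hpoly P hP) (hne P hP)
  · rintro _ (⟨P, hP, rfl⟩ | ⟨_, ⟨P, hP, rfl⟩, rfl⟩) F hF
    · exact coneComplex_face_mem_of_coneOver hC hP hF
    · exact coneComplex_face_mem_of_recCone_prod_zero hC hP hF
  · rintro _ (⟨P, hP, rfl⟩ | ⟨_, ⟨P, hP, rfl⟩, rfl⟩) _
      (⟨Q, hQ, rfl⟩ | ⟨_, ⟨Q, hQ, rfl⟩, rfl⟩) ⟨u, s⟩ ⟨h1, h2⟩
    -- At height zero the claim reduces to recession cones. At positive height, rescaling gives a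
    -- common point of `P` and `Q`, and both smallest faces equal the one in the cone over `P ∩ Q`.
    · rcases (coneOver_snd_nonneg h1).eq_or_lt with hs | hs
      · have hs' : s = 0 := hs.symm
        subst hs'
        rw [minFace_coneOver_mk_zero (hpoly P hP) (hne P hP),
          minFace_coneOver_mk_zero (hpoly Q hQ) (hne Q hQ),
          hrec P hP Q hQ u ((mk_zero_mem_coneOver (hpoly P hP) (hne P hP)).1 h1)
            ((mk_zero_mem_coneOver (hpoly Q hQ) (hne Q hQ)).1 h2)]
      · have hP' := inv_smul_mem_of_mem_coneOver (hpoly P hP) (hne P hP) h1 hs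
        have hQ' := inv_smul_mem_of_mem_coneOver (hpoly Q hQ) (hne Q hQ) h2 hs
        rcases hC.inter_face P hP Q hQ with hdisj | ⟨hf, hf'⟩
        · exact absurd hQ' (Set.disjoint_left.1 hdisj hP')
        · have hmem : (u, s) ∈ coneOver (P ∩ Q) := mem_coneOver_of_inv_smul_mem hs ⟨hP', hQ'⟩
          rw [← minFace_coneOver_of_isFaceOf (hpoly P hP) hf hmem,
            minFace_coneOver_of_isFaceOf (hpoly Q hQ) hf' hmem]
    · obtain ⟨huQ, hs : s = 0⟩ := h2
      subst hs
      simp only [minFace_prod_zero]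
      rw [minFace_coneOver_mk_zero (hpoly P hP) (hne P hP),
        hrec P hP Q hQ u ((mk_zero_mem_coneOver (hpoly P hP) (hne P hP)).1 h1) huQ]
    · obtain ⟨huP, hs : s = 0⟩ := h1
      subst hs
      simp only [minFace_prod_zero]
      rw [minFace_coneOver_mk_zero (hpoly Q hQ) (hne Q hQ),
        hrec P hP Q hQ u huP ((mk_zero_mem_coneOver (hpoly Q hQ) (hne Q hQ)).1 h2)]
    · obtain ⟨huP, hs : s = 0⟩ := h1
      subst hs
      simp only [minFace_prod_zero]
      rw [hrec P hP Q hQ u huP h2.1]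

theorem complexSupport_coneComplex (hC : IsPolyhedralComplex C) :
    complexSupport (coneComplex C) = coneOver (complexSupport C) := by
  apply Set.Subset.antisymm
  · rintro ⟨u, s⟩ ⟨_, ⟨P, hP, rfl⟩ | ⟨_, ⟨P, hP, rfl⟩, rfl⟩, hw⟩
    · exact coneOver_mono (Set.subset_sUnion_of_mem hP) hw
    · obtain ⟨hu, hs : s = 0⟩ := hw
      subst hs
      exact coneOver_mono (Set.subset_sUnion_of_mem hP)
        ((mk_zero_mem_coneOver (hC.isPolyhedron P hP) (hC.nonempty_of_mem P hP)).2 hu)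
  · have hclosed : IsClosed (⋃ P ∈ C, coneOver P) :=
      hC.finite.isClosed_biUnion fun P _ => isClosed_closure
    have hsub : coneOver (complexSupport C) ⊆ ⋃ P ∈ C, coneOver P := by
      refine closure_minimal ?_ hclosed
      rintro _ ⟨c, hc, w, ⟨⟨P, hP, hwP⟩, hw1⟩, rfl⟩
      exact Set.mem_biUnion hP (subset_closure ⟨c, hc, w, ⟨hwP, hw1⟩, rfl⟩)
    refine hsub.trans ?_
    simp only [Set.iUnion_subset_iff]
    exact fun P hP => Set.subset_sUnion_of_mem (Or.inl ⟨P, hP, rfl⟩)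

theorem isRationalPolyhedron_coneOver {L : Submodule ℤ V} {P : Set V} (hne : P.Nonempty)
    (h : IsRationalPolyhedron L P) : IsRationalPolyhedron (latticeProdInt L) (coneOver P) := by
  obtain ⟨H, hH, hrat, rfl⟩ := h
  have := isRationalPolyhedron_polarCone (L := latticeProdInt L) (finite_homogenize hH)
    fun f hf l hl => exists_rat_of_mem_homogenize hrat hf hl
  rwa [← coneOver_polyhedronOf hne] at this

/-- All defining forms of the cone vanish on the direction of a line in it. The form `-snd` makes
the direction horizontal; the others make it the direction of a line in `P`. -/
theorem containsNoLine_coneOver {P : Set V} (hP : IsPolyhedron P) (hne : P.Nonempty)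
    (h : ContainsNoLine P) : ContainsNoLine (coneOver P) := by
  obtain ⟨H, -, rfl⟩ := hP
  rintro ⟨p, ⟨v, s⟩, hv, hline⟩
  change ∀ t : ℝ, p + t • (v, s) ∈ coneOver (polyhedronOf H) at hline
  rw [coneOver_polyhedronOf hne] at hline
  have hs : s = 0 := by
    simpa using eq_zero_of_line_mem_polarCone hline (Set.mem_insert _ _)
  subst hs
  refine hv (Prod.ext (containsNoLine_of_line_direction hne h fun k hk => ?_) rfl)
  simpa using eq_zero_of_line_mem_polarCone hline (Or.inr ⟨k, hk, rfl⟩)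

theorem containsNoLine_recCone_prod_zero {P : Set V} (hP : IsPolyhedron P) (hne : P.Nonempty)
    (h : ContainsNoLine P) : ContainsNoLine (recCone P ×ˢ ({0} : Set ℝ)) := by
  rintro ⟨p, v, hv, hline⟩
  refine containsNoLine_coneOver hP hne h ⟨p, v, hv, fun t => ?_⟩
  obtain ⟨h1, h2 : (p + t • v).2 = 0⟩ := hline t
  have := (mk_zero_mem_coneOver hP hne).2 h1
  rwa [← h2] at this

end ConeOver

end Topological

theorem theorem3p4 {V : Type*} [NormedAddCommGroup V] [NormedSpace ℝ V] [FiniteDimensional ℝ V]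
    (L : Submodule ℤ V) [DiscreteTopology L] [IsZLattice ℝ L]
    (C : Set (Set V)) (hC : IsPolyhedralComplex C)
    (hconn : IsConnected (complexSupport C))
    (hMW : MinkowskiWeylCondition (complexSupport C)) :
    (IsConicComplex (recComplex C) ∧
      complexSupport (recComplex C) = recCone (complexSupport C)) ∧
    (IsConicComplex (coneComplex C) ∧
      complexSupport (coneComplex C) ⊆ (Set.univ : Set V) ×ˢ Set.Ici (0 : ℝ) ∧
      complexSupport (coneComplex C) = coneOver (complexSupport C)) ∧
    (IsRationalCollection L C →
      IsRationalCollection L (recComplex C) ∧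
      IsRationalCollection (latticeProdInt L) (coneComplex C)) ∧
    (IsStronglyConvexCollection C →
      IsPolyhedralFan (recComplex C) ∧ IsPolyhedralFan (coneComplex C)) := by
  have hpoly := hC.isPolyhedron
  have hne := hC.nonempty_of_mem
  have hrec := isConicComplex_recComplex hC hconn hMW
  have hcone := isConicComplex_coneComplex hC hconn hMW
  have hsupp := complexSupport_coneComplex hC
  refine ⟨⟨hrec, complexSupport_recComplex hC hconn.nonempty hMW⟩, ⟨hcone, ?_, hsupp⟩, ?_, ?_⟩
  · rw [hsupp]
    exact fun w hw => ⟨Set.mem_univ _, coneOver_snd_nonneg hw⟩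
  · intro hrat
    constructor
    · rintro _ ⟨P, hP, rfl⟩
      exact isRationalPolyhedron_recCone (hne P hP) (hrat P hP)
    · rintro _ (⟨P, hP, rfl⟩ | ⟨_, ⟨P, hP, rfl⟩, rfl⟩)
      · exact isRationalPolyhedron_coneOver (hne P hP) (hrat P hP)
      · exact isRationalPolyhedron_recCone_prod_zero (hne P hP) (hrat P hP)
  · intro hsc
    refine ⟨⟨hrec, ?_⟩, ⟨hcone, ?_⟩⟩
    · rintro _ ⟨P, hP, rfl⟩
      exact containsNoLine_recCone (hpoly P hP) (hne P hP) (hsc P hP)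
    · rintro _ (⟨P, hP, rfl⟩ | ⟨_, ⟨P, hP, rfl⟩, rfl⟩)
      · exact containsNoLine_coneOver (hpoly P hP) (hne P hP) (hsc P hP)
      · exact containsNoLine_recCone_prod_zero (hpoly P hP) (hne P hP) (hsc P hP)
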